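/- **Theorem 2.** Let $(a;q)_\infty=\prod_{m\ge 0}(1-aq^{m})$, and let $p_{3,3}(n)$ be defined by $$\sum_{n=0}^{\infty}p_{3,3}(n)q^{n}=\frac{1}{(q;q)_{\infty}^{3}\,(q^{3};q^{3})_{\infty}^{3}}.$$ Then for all integers $n\geq 0$ and $\alpha\geq 1$, $$p_{3,3}\left(3^{\alpha}n+\frac{3^{\alpha}+1}{2}\right)\equiv 0\pmod{3^{\alpha+1}}$$ and $$p_{3,3}\left(3^{\alpha+1}n+\frac{5\cdot 3^{\alpha}+1}{2}\right)\equiv 0\pmod{3^{\alpha+4}}.$$ -/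

import Mathlib

open PowerSeries
open scoped PowerSeries.WithPiTopology

/-- The `q`-Pochhammer symbol `(a; q)_∞ = ∏_{n ≥ 0} (1 - a q^n)` for formal power series `a`, `q` with
integer coefficients. The product is taken in the topology of coefficientwise convergence. -/
noncomputable def qPoch (a q : ℤ⟦X⟧) : ℤ⟦X⟧ := ∏' n : ℕ, (1 - a * q ^ n)

/-- The Euler product `E_k = (q^k; q^k)_∞`, where the variable `q` is the formal variable `X`. -/
noncomputable def eulerE (k : ℕ) : ℤ⟦X⟧ := qPoch (X ^ k) (X ^ k)

/-- For `k ≥ 1` the infinite product that defines `eulerE k` converges. -/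
theorem eulerE_multipliable (k : ℕ) (hk : 0 < k) :
    Multipliable fun n : ℕ => (1 : ℤ⟦X⟧) - X ^ k * (X ^ k) ^ n := by
  simp_rw [sub_eq_add_neg]
  apply WithPiTopology.multipliable_one_add_of_tendsto_order_atTop_nhds_top
  refine ENat.tendsto_nhds_top_iff_natCast_lt.mpr
    (fun n => Filter.eventually_atTop.mpr ⟨n, fun m hm => ?_⟩)
  rw [order_neg, ← pow_succ', ← pow_mul, order_X_pow]
  norm_cast
  nlinarith

/-- For `k ≥ 1` the series `eulerE k` has constant term `1`. -/
theorem eulerE_constantCoeff (k : ℕ) (hk : 0 < k) : constantCoeff (eulerE k) = 1 := by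
  rw [eulerE, qPoch, (eulerE_multipliable k hk).map_tprod _
    (WithPiTopology.continuous_constantCoeff ℤ)]
  simp [hk.ne']

/-- The generating function `1 / (E_1^3 E_k^3)`, for `k ≥ 1`: the inverse of `E_1^3 E_k^3`, whose
constant term is `1`, in the ring of formal power series with integer coefficients. -/
noncomputable def genP (k : ℕ) : ℤ⟦X⟧ := invOfUnit (eulerE 1 ^ 3 * eulerE k ^ 3) 1

/-- `genP k` is a genuine inverse. -/
theorem genP_spec (k : ℕ) (hk : 0 < k) : eulerE 1 ^ 3 * eulerE k ^ 3 * genP k = 1 := by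
  refine mul_invOfUnit _ _ ?_
  simp [eulerE_constantCoeff 1 one_pos, eulerE_constantCoeff k hk]

/-- `p_{k,3}(n)` for `k ≥ 1`: the number of 2-color partition triples of `n` in which one of the
colors appears only in parts that are multiples of `k`, as the coefficient of `q^n` in
`1 / (E_1^3 E_k^3)`. -/
noncomputable def pTriple (k n : ℕ) : ℤ := coeff n (genP k)

/-! Write E = `eulerE 1`, E_3 = E(X^3), E_9 = E(X^9) and U = `multisect 3 0`. Jacobi's identity for
E^3 gives the 3-dissection E^3 = P(X^3) - 3X E_9^3. Multiplying it over the substitutions X ↦ ω^i X,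
with ω a primitive cube root of unity, gives (P^3 - 27X E_3^9) E_3^3 = E^12. Hence w = P(X^3)/E^3
and u = 3X E_3^12/E^12 satisfy w - 1 = 3X E_9^3/E^3, u = (w - 1)(3w^2 - 3w + 1) and w^3 = (1 +
9u(X^3))(3w^2 - 3w + 1). With the values of U at w and w^2, the cubic makes U send ℤ[w] into ℤ[9u],
and polynomials vanishing at w = 1 into 9u ℤ[9u] (`exists_multisect_aeval_eq_mul`).

Let G_α be the generating function of the first progression. By induction, E^3 E_3^3 X G_α = 3^α u
r(9u) for some r in ℤ[X] (`genProgression_relation`): multiplying by (w - 1)/3 turns E^3 into X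
E_9^3, U then produces G_{α+1}, and the 9 coming from U against the 1/3 nets one power of 3. Since 3
∣ u, the first congruence follows. Multiplying by w instead turns E^3 into P(X^3); U then selects
the second progression and produces 27u (`exists_multisect_uSeries_mul_wSeries`), in all 3^(α+4). -/

/-- The Gaussian binomial coefficient. -/
def qBinom {R : Type*} [CommRing R] (q : R) : ℕ → ℕ → R
  | _, 0 => 1
  | 0, _ + 1 => 0
  | n + 1, k + 1 => qBinom q n k + q ^ (k + 1) * qBinom q n (k + 1)

/-- The finite product `(1 - q) (1 - q ^ 2) ⋯ (1 - q ^ n)`. -/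
def qFact {R : Type*} [CommRing R] (q : R) (n : ℕ) : R :=
  ∏ i ∈ Finset.range n, (1 - q ^ (i + 1))

/-! ### Gaussian binomials and a finite Jacobi identity -/

section QBinomial

variable {R : Type*} [CommRing R]

theorem qBinom_zero_right (q : R) (n : ℕ) : qBinom q n 0 = 1 := by
  cases n <;> rfl

theorem qBinom_succ_succ (q : R) (n k : ℕ) :
    qBinom q (n + 1) (k + 1) = qBinom q n k + q ^ (k + 1) * qBinom q n (k + 1) := rfl

theorem qBinom_eq_zero_of_lt (q : R) {n k : ℕ} (h : n < k) : qBinom q n k = 0 := by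
  induction n generalizing k with
  | zero =>
    obtain ⟨k, rfl⟩ := Nat.exists_eq_add_of_lt h
    rfl
  | succ n ih =>
    obtain ⟨k, rfl⟩ : ∃ j, k = j + 1 := ⟨k - 1, by omega⟩
    rw [qBinom_succ_succ, ih (by omega), ih (by omega)]
    simp

theorem qBinom_self (q : R) (n : ℕ) : qBinom q n n = 1 := by
  induction n with
  | zero => rfl
  | succ n ih => rw [qBinom_succ_succ, ih, qBinom_eq_zero_of_lt q (Nat.lt_succ_self n)]; simp

theorem qFact_succ (q : R) (n : ℕ) : qFact q (n + 1) = qFact q n * (1 - q ^ (n + 1)) :=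
  Finset.prod_range_succ _ _

theorem qBinom_mul_qFact_mul_qFact (q : R) (a b : ℕ) :
    qBinom q (a + b) a * qFact q a * qFact q b = qFact q (a + b) := by
  induction hN : a + b generalizing a b with
  | zero =>
    obtain ⟨rfl, rfl⟩ : a = 0 ∧ b = 0 := by omega
    simp [qFact, qBinom_zero_right]
  | succ N ih =>
    rcases a with _ | a
    · obtain rfl : b = N + 1 := by omega
      simp [qFact, qBinom_zero_right]
    rcases b with _ | b
    · obtain rfl : a = N := by omega
      rw [qBinom_self]
      simp [qFact]
    have h1 := ih a (b + 1) (by omega)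
    have h2 := ih (a + 1) b (by omega)
    have hab : N + 1 = (a + 1) + (b + 1) := by omega
    rw [qBinom_succ_succ, qFact_succ q N, hab]
    rw [qFact_succ q b] at h1 ⊢
    rw [qFact_succ q a] at h2 ⊢
    linear_combination (1 - q ^ (a + 1)) * h1 + q ^ (a + 1) * (1 - q ^ (b + 1)) * h2

/-- The homogeneous `q`-binomial theorem. -/
theorem prod_sub_mul_pow_eq_sum_qBinom (q y z : R) (N : ℕ) :
    ∏ i ∈ Finset.range N, (y - z * q ^ i) =
      ∑ j ∈ Finset.range (N + 1), (-1) ^ j * qBinom q N j * q ^ j.choose 2 * z ^ j * y ^ (N - j) := by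
  induction N generalizing z with
  | zero => simp [qBinom_zero_right]
  | succ N ih =>
    have h : ∀ i, y - z * q ^ (i + 1) = y - z * q * q ^ i := fun i => by ring
    rw [Finset.prod_range_succ']
    simp_rw [h]
    rw [ih, Finset.sum_range_succ' _ (N + 1), pow_zero, mul_one, mul_sub, Finset.sum_mul,
      Finset.sum_mul]
    have h1 : ∑ j ∈ Finset.range (N + 1),
        (-1) ^ j * qBinom q N j * q ^ j.choose 2 * (z * q) ^ j * y ^ (N - j) * y =
        ∑ j ∈ Finset.range (N + 1), (-1) ^ (j + 1) * qBinom q N (j + 1) * q ^ (j + 1).choose 2 *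
          (z * q) ^ (j + 1) * y ^ (N - j) + y ^ (N + 1) := by
      rw [Finset.sum_range_succ', Finset.sum_range_succ _ N, qBinom_eq_zero_of_lt q N.lt_succ_self]
      simp only [qBinom_zero_right, mul_zero, zero_mul, add_zero]
      congr 1
      · refine Finset.sum_congr rfl fun j hj => ?_
        have : N - j = N - (j + 1) + 1 := by have := Finset.mem_range.1 hj; omega
        rw [this, pow_succ y]
        ring
      · simp [pow_succ]
    rw [h1, add_sub_right_comm, ← Finset.sum_sub_distrib]
    congr 1
    · refine Finset.sum_congr rfl fun j _ => ?_
      have : (j + 1).choose 2 = j + j.choose 2 := by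
        rw [Nat.choose_succ_succ' j 1, Nat.choose_one_right]
      rw [qBinom_succ_succ, this, Nat.add_sub_add_right]
      ring
    · simp [qBinom_zero_right]

theorem qBinom_map {S : Type*} [CommRing S] (f : R →+* S) (q : R) (n k : ℕ) :
    f (qBinom q n k) = qBinom (f q) n k := by
  induction n generalizing k with
  | zero => cases k <;> simp [qBinom]
  | succ n ih => cases k <;> simp [qBinom, ih]

theorem prod_pow_sub_pow (q : R) (n : ℕ) :
    ∏ i ∈ Finset.range n, (q ^ n - q ^ i) = (-1) ^ n * q ^ n.choose 2 * qFact q n := by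
  induction n with
  | zero => simp [qFact]
  | succ n ih =>
    have h : ∀ i, q ^ (n + 1) - q ^ (i + 1) = q * (q ^ n - q ^ i) := fun i => by ring
    rw [Finset.prod_range_succ', Nat.choose_succ_succ' n 1, Nat.choose_one_right, qFact_succ]
    simp_rw [h]
    rw [Finset.prod_mul_distrib, ih, Finset.prod_const, Finset.card_range]
    ring

theorem prod_pow_sub_pow_add (q : R) (n : ℕ) :
    ∏ i ∈ Finset.range n, (q ^ n - q ^ (n + (1 + i))) = q ^ (n * n) * qFact q n := by
  have h : ∀ i, q ^ n - q ^ (n + (1 + i)) = q ^ n * (1 - q ^ (i + 1)) := fun i => by ring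
  simp_rw [h]
  rw [Finset.prod_mul_distrib, Finset.prod_const, Finset.card_range, ← pow_mul, qFact]

/-- The derivative of the `q`-binomial theorem at the root `z = 1` of `∏ (q ^ n - z q ^ i)`. -/
theorem sum_mul_qBinom_eq (q : R) (n : ℕ) :
    ∑ j ∈ Finset.range (2 * n + 2), (-1) ^ j * (j : R) * qBinom q (2 * n + 1) j *
        q ^ (j.choose 2 + n * (2 * n + 1 - j)) =
      (-1) ^ (n + 1) * q ^ (n + n * n + n.choose 2) * qFact q n ^ 2 := by
  have key := prod_sub_mul_pow_eq_sum_qBinom (Polynomial.C q) (Polynomial.C (q ^ n)) Polynomial.X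
    (2 * n + 1)
  have hsplit : 2 * n + 1 = n + (1 + n) := by ring
  replace key := congrArg (fun p => (Polynomial.derivative p).eval 1) key
  simp only [← qBinom_map] at key
  have hR : (Polynomial.derivative (∑ j ∈ Finset.range (2 * n + 1 + 1),
      (-1) ^ j * Polynomial.C (qBinom q (2 * n + 1) j) * Polynomial.C q ^ j.choose 2 *
      Polynomial.X ^ j * Polynomial.C (q ^ n) ^ (2 * n + 1 - j))).eval 1 =
      ∑ j ∈ Finset.range (2 * n + 2), (-1) ^ j * (j : R) * qBinom q (2 * n + 1) j *
        q ^ (j.choose 2 + n * (2 * n + 1 - j)) := by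
    rw [Polynomial.derivative_sum, Polynomial.eval_finsetSum]
    refine Finset.sum_congr rfl fun j _ => ?_
    have : (-1) ^ j * Polynomial.C (qBinom q (2 * n + 1) j) * Polynomial.C q ^ j.choose 2 *
      Polynomial.X ^ j * Polynomial.C (q ^ n) ^ (2 * n + 1 - j) =
      Polynomial.C ((-1) ^ j * qBinom q (2 * n + 1) j *
        q ^ (j.choose 2 + n * (2 * n + 1 - j))) * Polynomial.X ^ j := by
      simp only [map_mul, map_pow, map_neg, map_one, pow_add, pow_mul]
      ring
    rw [this, Polynomial.derivative_C_mul, Polynomial.derivative_X_pow]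
    simp
    ring
  -- The middle factor i = n is q^n (1 - z), so at z = 1 only the term differentiating it survives.
  have hL : ∀ A B : Polynomial R, (Polynomial.derivative (A * ((Polynomial.C (q ^ n) -
      Polynomial.X * Polynomial.C q ^ (n + 0)) * B))).eval 1 = - q ^ n * A.eval 1 * B.eval 1 := by
    intro A B
    rw [← Polynomial.C_pow]
    simp only [add_zero, Polynomial.derivative_mul, Polynomial.derivative_sub,
      Polynomial.derivative_C, Polynomial.derivative_X, Polynomial.eval_add, Polynomial.eval_mul,
      Polynomial.eval_sub, Polynomial.eval_C, Polynomial.eval_X, Polynomial.eval_zero,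
      Polynomial.eval_one]
    ring
  rw [← hR, ← key, hsplit, Finset.prod_range_add, Finset.prod_range_add, Finset.prod_range_one, hL]
  have hB : Polynomial.eval 1 (∏ x ∈ Finset.range n, (Polynomial.C (q ^ n) -
      Polynomial.X * Polynomial.C q ^ (n + (1 + x)))) = q ^ (n * n) * qFact q n := by
    rw [Polynomial.eval_prod, ← prod_pow_sub_pow_add]
    simp
  have hA : Polynomial.eval 1 (∏ x ∈ Finset.range n, (Polynomial.C (q ^ n) -
      Polynomial.X * Polynomial.C q ^ x)) = (-1) ^ n * q ^ n.choose 2 * qFact q n := by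
    rw [Polynomial.eval_prod, ← prod_pow_sub_pow]
    simp
  rw [hA, hB]
  ring

theorem qFact_ne_zero [IsDomain R] {q : R} (hq : ∀ n, q ^ (n + 1) ≠ 1) (n : ℕ) :
    qFact q n ≠ 0 :=
  Finset.prod_ne_zero_iff.2 fun i _ => sub_ne_zero.2 (hq i).symm

theorem qBinom_symm [IsDomain R] {q : R} (hq : ∀ n, q ^ (n + 1) ≠ 1) (a b : ℕ) :
    qBinom q (a + b) b = qBinom q (a + b) a := by
  refine mul_right_cancel₀ (mul_ne_zero (qFact_ne_zero hq a) (qFact_ne_zero hq b)) ?_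
  have h := qBinom_mul_qFact_mul_qFact q b a
  rw [add_comm b a] at h
  linear_combination h - qBinom_mul_qFact_mul_qFact q a b

/-- A finite form of Jacobi's identity for the cube of the Euler product. -/
theorem qFact_sq_eq_sum [IsDomain R] {q : R} (hq0 : q ≠ 0) (hq : ∀ n, q ^ (n + 1) ≠ 1) (n : ℕ) :
    qFact q n ^ 2 = ∑ k ∈ Finset.range (n + 1),
      (-1) ^ k * (2 * k + 1) * q ^ (k + 1).choose 2 * qBinom q (2 * n + 1) (n - k) := by
  have key := sum_mul_qBinom_eq q n
  -- Fold the sum about its middle: j = n - k and j = n + 1 + k carry the same Gaussian binomial and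
  -- power of q with opposite signs, so their weights combine to (n + 1 + k) - (n - k) = 2k + 1.
  rw [show 2 * n + 2 = (n + 1) + (n + 1) by ring, Finset.sum_range_add,
    ← Finset.sum_range_reflect _ (n + 1), ← Finset.sum_add_distrib] at key
  have hne : (-1) ^ (n + 1) * q ^ (n + n * n + n.choose 2) ≠ 0 := by simp [hq0]
  refine mul_left_cancel₀ hne ?_
  rw [← key, Finset.mul_sum]
  refine Finset.sum_congr rfl fun k hk => ?_
  obtain ⟨m, rfl⟩ : ∃ m, n = m + k :=
    ⟨n - k, by have := Finset.mem_range.1 hk; omega⟩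
  have e1 : m + k + 1 - 1 - k = m := by omega
  have e2 : 2 * (m + k) + 1 - m = m + k + 1 + k := by omega
  have e3 : 2 * (m + k) + 1 - (m + k + 1 + k) = m := by omega
  have e4 : m + k - k = m := by omega
  have e5 : 2 * (m + k) + 1 = m + (m + k + 1 + k) := by omega
  have s1 : m.choose 2 + (m + k) * (m + k + 1 + k) =
      (m + k) + (m + k) * (m + k) + (m + k).choose 2 + (k + 1).choose 2 := by
    rw [← Nat.cast_inj (R := ℚ)]
    push_cast [Nat.cast_choose_two]
    ring
  have s2 : (m + k + 1 + k).choose 2 + (m + k) * m =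
      (m + k) + (m + k) * (m + k) + (m + k).choose 2 + (k + 1).choose 2 := by
    rw [← Nat.cast_inj (R := ℚ)]
    push_cast [Nat.cast_choose_two]
    ring
  rw [e1, e2, e3, e4, s1, s2, e5, qBinom_symm hq m (m + k + 1 + k)]
  push_cast
  have : ((-1 : R)) ^ k * (-1) ^ k = 1 := by rw [← mul_pow]; simp
  simp only [pow_add, pow_one]
  linear_combination (-(-1) ^ m * (m : R) * q ^ m * q ^ k * q ^ ((m + k) * (m + k)) *
    q ^ (m + k).choose 2 * q ^ (k + 1).choose 2 * qBinom q (m + (m + k + 1 + k)) m) * this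

end QBinomial

/-! ### Jacobi's identity for E^3, modulo powers of X -/

section Jacobi

theorem eq_zero_of_forall_X_pow_dvd {R : Type*} [Semiring R] {f : R⟦X⟧} (h : ∀ n, X ^ n ∣ f) :
    f = 0 := by
  ext n
  simpa using X_pow_dvd_iff.1 (h (n + 1)) n n.lt_succ_self

theorem X_pow_succ_ne_one {R : Type*} [Semiring R] [Nontrivial R] (n : ℕ) :
    (X : R⟦X⟧) ^ (n + 1) ≠ 1 := by
  intro h
  simpa using congrArg constantCoeff h

theorem tendsto_qFact_eulerE :
    Filter.Tendsto (fun n => qFact (X : ℤ⟦X⟧) n) Filter.atTop (nhds (eulerE 1)) := by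
  have h := (eulerE_multipliable 1 one_pos).hasProd.tendsto_prod_nat
  refine h.congr fun n => Finset.prod_congr rfl fun i _ => ?_
  rw [pow_one, ← pow_succ']

theorem X_pow_dvd_qFact_sub_qFact {n m : ℕ} (h : n ≤ m) :
    (X : ℤ⟦X⟧) ^ (n + 1) ∣ qFact X m - qFact X n := by
  induction m, h using Nat.le_induction with
  | base => simp
  | succ m hm ih =>
    have : qFact (X : ℤ⟦X⟧) (m + 1) - qFact X n =
        (qFact X m - qFact X n) - X ^ (m + 1) * qFact X m := by rw [qFact_succ]; ring
    rw [this]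
    exact dvd_sub ih ((pow_dvd_pow _ (by omega)).mul_right _)

theorem X_pow_dvd_eulerE_sub_qFact (n : ℕ) : (X : ℤ⟦X⟧) ^ (n + 1) ∣ eulerE 1 - qFact X n := by
  rw [X_pow_dvd_iff]
  intro k hk
  have h := ((WithPiTopology.continuous_coeff ℤ k).tendsto _).comp tendsto_qFact_eulerE
  have h2 : Filter.Tendsto (fun m => coeff k (qFact (X : ℤ⟦X⟧) m)) Filter.atTop
      (nhds (coeff k (qFact (X : ℤ⟦X⟧) n))) := by
    refine tendsto_const_nhds.congr' ?_
    filter_upwards [Filter.eventually_ge_atTop n] with m hm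
    have := X_pow_dvd_iff.1 (X_pow_dvd_qFact_sub_qFact hm) k hk
    rw [map_sub] at this
    linarith
  rw [map_sub, sub_eq_zero]
  exact tendsto_nhds_unique h h2

theorem isUnit_eulerE {k : ℕ} (hk : 0 < k) : IsUnit (eulerE k) := by
  rw [isUnit_iff_constantCoeff, eulerE_constantCoeff k hk]
  exact isUnit_one

/-- In [a+b, a] (q)_a (q)_b = (q)_{a+b}, all three finite products agree with E modulo X^(a+1), and
E is a unit. -/
theorem X_pow_dvd_qBinom_mul_eulerE_sub_one (a b : ℕ) (hab : a ≤ b) :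
    (X : ℤ⟦X⟧) ^ (a + 1) ∣ qBinom X (a + b) a * eulerE 1 - 1 := by
  have hE := isUnit_eulerE one_pos
  rw [← hE.dvd_mul_left]
  have h1 := X_pow_dvd_eulerE_sub_qFact a
  have h2 := (pow_dvd_pow _ (by omega)).trans (X_pow_dvd_eulerE_sub_qFact b) (a := X ^ (a + 1))
  have h3 := (pow_dvd_pow _ (by omega)).trans (X_pow_dvd_eulerE_sub_qFact (a + b))
    (a := X ^ (a + 1))
  have h : eulerE 1 * (qBinom X (a + b) a * eulerE 1 - 1) =
      qBinom X (a + b) a * eulerE 1 * (eulerE 1 - qFact X a) +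
      qBinom X (a + b) a * qFact X a * (eulerE 1 - qFact X b) -
      (eulerE 1 - qFact X (a + b)) := by
    linear_combination qBinom_mul_qFact_mul_qFact (X : ℤ⟦X⟧) a b
  rw [h]
  exact dvd_sub (dvd_add (h1.mul_left _) (h2.mul_left _)) h3

/-- Multiply the finite identity by E. The k-th binomial approximates 1/E only to order n - k + 1,
but the accompanying power of X has exponent at least k and makes up the loss. -/
theorem X_pow_dvd_eulerE_cube_sub_sum (n : ℕ) :
    (X : ℤ⟦X⟧) ^ n ∣ eulerE 1 ^ 3 -
      ∑ k ∈ Finset.range n, (-1) ^ k * (2 * (k : ℤ⟦X⟧) + 1) * X ^ (k + 1).choose 2 := by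
  rcases n with _ | n
  · simp
  have h := qFact_sq_eq_sum (X_ne_zero (R := ℤ)) X_pow_succ_ne_one n
  have e : eulerE 1 ^ 3 - ∑ k ∈ Finset.range (n + 1),
      (-1) ^ k * (2 * (k : ℤ⟦X⟧) + 1) * X ^ (k + 1).choose 2 =
      eulerE 1 * (eulerE 1 + qFact X n) * (eulerE 1 - qFact X n) +
      ∑ k ∈ Finset.range (n + 1), (-1) ^ k * (2 * (k : ℤ⟦X⟧) + 1) *
        (X ^ (k + 1).choose 2 * (qBinom X (2 * n + 1) (n - k) * eulerE 1 - 1)) := by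
    have : ∑ k ∈ Finset.range (n + 1), (-1) ^ k * (2 * (k : ℤ⟦X⟧) + 1) *
        (X ^ (k + 1).choose 2 * (qBinom X (2 * n + 1) (n - k) * eulerE 1 - 1)) =
        (∑ k ∈ Finset.range (n + 1), (-1) ^ k * (2 * (k : ℤ⟦X⟧) + 1) * X ^ (k + 1).choose 2 *
          qBinom X (2 * n + 1) (n - k)) * eulerE 1 - ∑ k ∈ Finset.range (n + 1),
            (-1) ^ k * (2 * (k : ℤ⟦X⟧) + 1) * X ^ (k + 1).choose 2 := by
      rw [Finset.sum_mul, ← Finset.sum_sub_distrib]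
      exact Finset.sum_congr rfl fun k _ => by ring
    rw [this, ← h]
    ring
  rw [e]
  refine dvd_add ((X_pow_dvd_eulerE_sub_qFact n).mul_left _) (Finset.dvd_sum fun k hk => ?_)
  refine Dvd.dvd.mul_left ?_ _
  have hk := Finset.mem_range.1 hk
  have h1 := X_pow_dvd_qBinom_mul_eulerE_sub_one (n - k) (n + k + 1) (by omega)
  rw [show n - k + (n + k + 1) = 2 * n + 1 by omega] at h1
  have h2 : k ≤ (k + 1).choose 2 := by
    rw [Nat.choose_succ_succ' k 1, Nat.choose_one_right]
    omega
  refine (pow_dvd_pow _ (?_ : n + 1 ≤ (k + 1).choose 2 + (n - k + 1))).trans ?_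
  · omega
  · rw [pow_add]
    exact mul_dvd_mul_left _ h1

end Jacobi

/-! ### Extraction of residue classes of exponents -/

/-- The series `∑ a (m n + r) X ^ n` made from the coefficients of `∑ a n X ^ n` in a residue
class. -/
noncomputable def multisect {R : Type*} [CommRing R] (m r : ℕ) : R⟦X⟧ →ₗ[R] R⟦X⟧ where
  toFun f := mk fun n => coeff (m * n + r) f
  map_add' f g := by ext; simp
  map_smul' c f := by ext; simp

section Multisect

variable {R : Type*} [CommRing R]

@[simp]
theorem coeff_multisect (m r n : ℕ) (f : R⟦X⟧) :
    coeff n (multisect m r f) = coeff (m * n + r) f := by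
  simp [multisect]

theorem multisect_X_pow_mul_expand {m : ℕ} (hm : m ≠ 0) {r s : ℕ} (hr : r < m) (hs : s < m)
    (f : R⟦X⟧) :
    multisect m r (X ^ s * expand m hm f) = if r = s then f else 0 := by
  ext n
  rw [coeff_multisect, coeff_X_pow_mul']
  split_ifs with h1 h2 h2
  · subst h2
    simp [coeff_expand_mul]
  · rw [map_zero]
    refine coeff_expand_of_not_dvd _ hm _ fun h => h2 ?_
    have := (Nat.modEq_iff_dvd' h1).2 h
    rw [Nat.ModEq, Nat.mul_add_mod, Nat.mod_eq_of_lt hs, Nat.mod_eq_of_lt hr] at this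
    exact this.symm
  · omega
  · simp

theorem X_pow_dvd_multisect_X_pow_mul {m r : ℕ} (hr : r < m) (k : ℕ) (f : R⟦X⟧) :
    X ^ k ∣ multisect m r (X ^ (m * k) * f) := by
  rw [X_pow_dvd_iff]
  intro n hn
  rw [coeff_multisect, coeff_X_pow_mul', if_neg]
  nlinarith

theorem eq_sum_multisect {m : ℕ} (hm : m ≠ 0) (f : R⟦X⟧) :
    f = ∑ r ∈ Finset.range m, X ^ r * expand m hm (multisect m r f) := by
  ext n
  rw [map_sum, Finset.sum_eq_single (n % m)]
  · rw [coeff_X_pow_mul', if_pos (Nat.mod_le n m), ← Nat.mul_div_self_eq_mod_sub_self,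
      coeff_expand_mul, coeff_multisect, Nat.div_add_mod]
  · intro s hs hne
    rw [coeff_X_pow_mul']
    split_ifs with h
    · refine coeff_expand_of_not_dvd _ hm _ fun h' => hne ?_
      have := (Nat.modEq_iff_dvd' h).2 h'
      rwa [Nat.ModEq, Nat.mod_eq_of_lt (Finset.mem_range.1 hs)] at this
    · rfl
  · exact fun h => absurd (Finset.mem_range.2 (Nat.mod_lt n (Nat.pos_of_ne_zero hm))) h

/-- Multiplying by a series in X^m preserves residue classes of exponents, so such series act as
scalars for `multisect`. -/
theorem multisect_expand_mul {m : ℕ} (hm : m ≠ 0) (r : ℕ) (hr : r < m) (f g : R⟦X⟧) :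
    multisect m r (expand m hm f * g) = f * multisect m r g := by
  conv_lhs => rw [eq_sum_multisect hm g]
  rw [Finset.mul_sum, map_sum]
  have h : ∀ s ∈ Finset.range m, multisect m r (expand m hm f *
      (X ^ s * expand m hm (multisect m s g))) = if r = s then f * multisect m s g else 0 := by
    intro s hs
    rw [mul_left_comm, ← map_mul, multisect_X_pow_mul_expand hm hr (Finset.mem_range.1 hs)]
  rw [Finset.sum_congr rfl h, Finset.sum_ite_eq, if_pos (Finset.mem_range.2 hr)]

end Multisect

/-! ### The 3-dissection of E^3 -/

section Dissection

/-- The triangular number k(k+1)/2 is divisible by 3 for k ≡ 0, 2 mod 3. For k = 3M + 1 it is 9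
M(M+1)/2 + 1, with weight 2k + 1 = 3(2M + 1) and sign -(-1)^M: this class is -3X times the original
series in X^9. -/
theorem exists_sum_eq_expand_sub (M : ℕ) : ∃ p : ℤ⟦X⟧,
    ∑ k ∈ Finset.range (3 * M), (-1) ^ k * (2 * (k : ℤ⟦X⟧) + 1) * X ^ (k + 1).choose 2 =
      expand 3 three_ne_zero p - 3 * X * expand 3 three_ne_zero (expand 3 three_ne_zero
        (∑ k ∈ Finset.range M, (-1) ^ k * (2 * (k : ℤ⟦X⟧) + 1) * X ^ (k + 1).choose 2)) := by
  induction M with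
  | zero => exact ⟨0, by simp⟩
  | succ M ih =>
    obtain ⟨p, hp⟩ := ih
    obtain ⟨c, hc⟩ : ∃ c, c = (M + 1).choose 2 := ⟨_, rfl⟩
    have hcQ : (c : ℚ) = (M + 1) * M / 2 := by
      rw [hc]
      push_cast [Nat.cast_choose_two]
      ring
    have h0 : (3 * M + 1).choose 2 = 3 * (3 * c - M) := by
      have : M ≤ c := by
        rw [hc, Nat.choose_succ_succ' M 1, Nat.choose_one_right]
        omega
      rw [← Nat.cast_inj (R := ℚ)]
      push_cast [Nat.cast_choose_two, Nat.cast_sub (show M ≤ 3 * c by omega), hcQ]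
      ring
    have h1 : (3 * M + 1 + 1).choose 2 = 3 * (3 * c) + 1 := by
      rw [← Nat.cast_inj (R := ℚ)]
      push_cast [Nat.cast_choose_two, hcQ]
      ring
    have h2 : (3 * M + 2 + 1).choose 2 = 3 * (3 * c + M + 1) := by
      rw [← Nat.cast_inj (R := ℚ)]
      push_cast [Nat.cast_choose_two, hcQ]
      ring
    refine ⟨p + (-1) ^ M * (6 * (M : ℤ⟦X⟧) + 1) * X ^ (3 * c - M) +
      (-1) ^ M * (6 * (M : ℤ⟦X⟧) + 5) * X ^ (3 * c + M + 1), ?_⟩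
    rw [show 3 * (M + 1) = 3 * M + 1 + 1 + 1 by ring, Finset.sum_range_succ, Finset.sum_range_succ,
      Finset.sum_range_succ, hp, Finset.sum_range_succ, ← hc, h0, h1, h2]
    have hs : ((-1 : ℤ⟦X⟧)) ^ (3 * M) = (-1) ^ M := by rw [pow_mul]; norm_num
    simp only [map_add, map_mul, map_pow, expand_X, map_natCast, map_ofNat, map_neg, map_one,
      ← pow_mul, pow_add, hs]
    push_cast
    ring

/-- The 3-dissection of the cube of the Euler product. -/
theorem eulerE_cube_dissection :
    eulerE 1 ^ 3 = expand 3 three_ne_zero (multisect 3 0 (eulerE 1 ^ 3)) -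
      3 * X * expand 3 three_ne_zero (expand 3 three_ne_zero (eulerE 1)) ^ 3 := by
  have aux : ∀ M : ℕ, X ^ M ∣ multisect 3 1 (eulerE 1 ^ 3) +
      3 * expand 3 three_ne_zero (eulerE 1 ^ 3) ∧ X ^ M ∣ multisect 3 2 (eulerE 1 ^ 3) := by
    intro M
    obtain ⟨p, hp⟩ := exists_sum_eq_expand_sub M
    obtain ⟨g, hg⟩ := X_pow_dvd_eulerE_cube_sub_sum (3 * M)
    obtain ⟨h, hh⟩ := X_pow_dvd_eulerE_cube_sub_sum M
    set J := ∑ k ∈ Finset.range M, (-1) ^ k * (2 * (k : ℤ⟦X⟧) + 1) * X ^ (k + 1).choose 2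
    have h0 : eulerE 1 ^ 3 = X ^ 0 * expand 3 three_ne_zero p +
        X ^ 1 * expand 3 three_ne_zero (-3 * expand 3 three_ne_zero J) + X ^ (3 * M) * g := by
      rw [← hg, hp]
      simp only [map_mul, map_neg, map_ofNat]
      ring
    have hJ : expand 3 three_ne_zero (eulerE 1 ^ 3) = expand 3 three_ne_zero J +
        X ^ (3 * M) * expand 3 three_ne_zero h := by
      rw [← sub_eq_iff_eq_add', ← map_sub, hh, map_mul, map_pow, expand_X, ← pow_mul]
    constructor
    · rw [hJ]
      conv_rhs => rw [h0]
      rw [map_add, map_add, multisect_X_pow_mul_expand, multisect_X_pow_mul_expand]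
      · norm_num
        rw [mul_add, add_assoc, add_left_comm, neg_add_cancel_left]
        exact dvd_add (X_pow_dvd_multisect_X_pow_mul (by norm_num) M g)
          (((pow_dvd_pow _ (by omega)).mul_right _).mul_left _)
      all_goals norm_num
    · conv_rhs => rw [h0]
      rw [map_add, map_add, multisect_X_pow_mul_expand, multisect_X_pow_mul_expand]
      · norm_num
        exact X_pow_dvd_multisect_X_pow_mul (by norm_num) M g
      all_goals norm_num
  have h1 := eq_zero_of_forall_X_pow_dvd fun M => (aux M).1
  have h2 := eq_zero_of_forall_X_pow_dvd fun M => (aux M).2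
  conv_lhs => rw [eq_sum_multisect three_ne_zero (eulerE 1 ^ 3)]
  rw [Finset.sum_range_succ, Finset.sum_range_succ, Finset.sum_range_one, h2,
    eq_neg_of_add_eq_zero_left h1]
  simp only [map_neg, map_mul, map_ofNat, map_pow, map_zero]
  ring

end Dissection

/-! ### The product over cube roots of unity -/

section Norm

theorem one_sub_mul_one_sub_mul_one_sub {R : Type*} [CommRing R] {ω : R} (hω : 1 + ω + ω ^ 2 = 0)
    (x : R) : (1 - x) * (1 - ω * x) * (1 - ω ^ 2 * x) = 1 - x ^ 3 := by
  linear_combination (-x + x ^ 2 * ω - x ^ 3 * (ω - 1)) * hω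

/-- The conjugates of 1 - X^k multiply to 1 - X^(3k) if 3 ∤ k, and to (1 - X^k)^3 if 3 ∣ k. The
factors 1 - X^(9j) supply the terms missing from the first kind. -/
theorem prod_rescale_qFact {R : Type*} [CommRing R] {ω : R} (hω : 1 + ω + ω ^ 2 = 0) (n : ℕ) :
    qFact (X : R⟦X⟧) (3 * n) * rescale ω (qFact X (3 * n)) * rescale (ω ^ 2) (qFact X (3 * n)) *
      expand 3 three_ne_zero (expand 3 three_ne_zero (qFact X n)) =
    expand 3 three_ne_zero (qFact X (3 * n)) * expand 3 three_ne_zero (qFact X n) ^ 3 := by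
  have hω3 : ω ^ 3 = 1 := by linear_combination (ω - 1) * hω
  have hC : 1 + (C ω : R⟦X⟧) + C ω ^ 2 = 0 := by
    rw [← map_pow, ← map_one C, ← map_add, ← map_add, hω, map_zero]
  have hC3 : (C ω : R⟦X⟧) ^ 3 = 1 := by rw [← map_pow, hω3, map_one]
  induction n with
  | zero => simp [qFact]
  | succ n ih =>
    have hC3n : (C ω : R⟦X⟧) ^ (3 * n) = 1 := by rw [pow_mul, hC3, one_pow]
    have hr : ∀ k, rescale ω (X ^ k : R⟦X⟧) = C ω ^ k * X ^ k := fun k => by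
      rw [map_pow, rescale_X, mul_pow]
    have hr2 : ∀ k, rescale (ω ^ 2) (X ^ k : R⟦X⟧) = (C ω ^ 2) ^ k * X ^ k := fun k => by
      rw [map_pow, rescale_X, mul_pow, map_pow]
    have ha := one_sub_mul_one_sub_mul_one_sub hC (X ^ (3 * n + 1))
    have hb := one_sub_mul_one_sub_mul_one_sub hC (X ^ (3 * n + 1 + 1))
    have e1 : (C ω : R⟦X⟧) ^ (3 * n + 1) = C ω := by rw [pow_succ, hC3n, one_mul]
    have e2 : (C ω : R⟦X⟧) ^ (3 * n + 1 + 1) = C ω ^ 2 := by rw [pow_succ, e1, sq]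
    have e3 : (C ω : R⟦X⟧) ^ (3 * n + 1 + 1 + 1) = 1 := by rw [pow_succ, e2, ← pow_succ, hC3]
    have e4 : ((C ω : R⟦X⟧) ^ 2) ^ 2 = C ω := by
      linear_combination C ω * hC3
    have hx : ∀ k, expand 3 three_ne_zero (X ^ k : R⟦X⟧) = (X ^ k) ^ 3 := fun k => by
      rw [map_pow, expand_X, ← pow_mul, ← pow_mul, mul_comm]
    have hc : (X : R⟦X⟧) ^ (3 * n + 1 + 1 + 1) = (X ^ (n + 1)) ^ 3 := by ring
    rw [show 3 * (n + 1) = 3 * n + 1 + 1 + 1 by ring]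
    simp only [qFact_succ, map_mul, map_sub, map_one, hr, hr2, hx, pow_right_comm (C ω) 2, e1, e2,
      e3, e4, map_pow (expand 3 three_ne_zero) _ 3, one_pow, one_mul]
    simp only [hc]
    generalize 1 - (X : R⟦X⟧) ^ (3 * n + 1) = a0 at *
    generalize 1 - C ω * (X : R⟦X⟧) ^ (3 * n + 1) = a1 at *
    generalize 1 - C ω ^ 2 * (X : R⟦X⟧) ^ (3 * n + 1) = a2 at *
    generalize 1 - (X : R⟦X⟧) ^ (3 * n + 1 + 1) = b0 at *
    generalize 1 - C ω * (X : R⟦X⟧) ^ (3 * n + 1 + 1) = b1 at *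
    generalize 1 - C ω ^ 2 * (X : R⟦X⟧) ^ (3 * n + 1 + 1) = b2 at *
    generalize 1 - ((X : R⟦X⟧) ^ (3 * n + 1)) ^ 3 = a3 at *
    generalize 1 - ((X : R⟦X⟧) ^ (3 * n + 1 + 1)) ^ 3 = b3 at *
    generalize 1 - ((X : R⟦X⟧) ^ (n + 1)) ^ 3 = c0 at *
    generalize 1 - (((X : R⟦X⟧) ^ (n + 1)) ^ 3) ^ 3 = c1 at *
    rw [← ha, ← hb]
    linear_combination a0 * a1 * a2 * b0 * b1 * b2 * c0 ^ 3 * c1 * ih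

theorem continuous_of_continuous_coeff {R Y : Type*} [CommRing R] [TopologicalSpace R]
    [TopologicalSpace Y] {f : Y → R⟦X⟧} (h : ∀ n, Continuous fun y => coeff n (f y)) :
    Continuous f :=
  continuous_iff_continuousAt.2 fun y =>
    (WithPiTopology.tendsto_iff_coeff_tendsto R _ _ _).2 fun n => (h n).tendsto y

theorem continuous_expand {R : Type*} [CommRing R] [TopologicalSpace R] {m : ℕ} (hm : m ≠ 0) :
    Continuous (expand m hm : R⟦X⟧ →ₐ[R] R⟦X⟧) := by
  refine continuous_of_continuous_coeff fun n => ?_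
  simp_rw [coeff_expand]
  split_ifs
  · exact WithPiTopology.continuous_coeff R _
  · exact continuous_const

theorem continuous_rescale {R : Type*} [CommRing R] [TopologicalSpace R] [IsTopologicalRing R]
    (a : R) : Continuous (rescale a : R⟦X⟧ →+* R⟦X⟧) := by
  refine continuous_of_continuous_coeff fun n => ?_
  simp_rw [coeff_rescale]
  exact continuous_const.mul (WithPiTopology.continuous_coeff R _)

theorem continuous_map {R S : Type*} [CommRing R] [CommRing S] [TopologicalSpace R]
    [TopologicalSpace S] {f : R →+* S} (hf : Continuous f) :
    Continuous (PowerSeries.map f) := by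
  refine continuous_of_continuous_coeff fun n => ?_
  simp_rw [coeff_map]
  exact hf.comp (WithPiTopology.continuous_coeff R _)

theorem eulerE_eq_expand {k : ℕ} (hk : k ≠ 0) : eulerE k = expand k hk (eulerE 1) := by
  rw [eulerE, eulerE, qPoch, qPoch, (eulerE_multipliable 1 one_pos).map_tprod _
    (continuous_expand hk)]
  simp

theorem qFact_map {R S : Type*} [CommRing R] [CommRing S] (f : R →+* S) (q : R) (n : ℕ) :
    f (qFact q n) = qFact (f q) n := by
  simp [qFact]

theorem prod_rescale_eulerE {ω : ℂ} (hω : 1 + ω + ω ^ 2 = 0) (e : ℂ⟦X⟧)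
    (he : e = PowerSeries.map (Int.castRingHom ℂ) (eulerE 1)) :
    e * rescale ω e * rescale (ω ^ 2) e * expand 3 three_ne_zero (expand 3 three_ne_zero e) =
      expand 3 three_ne_zero e ^ 4 := by
  have h1 : Filter.Tendsto (fun n => qFact (X : ℂ⟦X⟧) n) Filter.atTop (nhds e) := by
    rw [he]
    have := ((continuous_map (f := Int.castRingHom ℂ) continuous_of_discreteTopology).tendsto
      _).comp tendsto_qFact_eulerE
    refine this.congr fun n => ?_
    simp [qFact_map]
  have h3 : Filter.Tendsto (fun n => qFact (X : ℂ⟦X⟧) (3 * n)) Filter.atTop (nhds e) :=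
    h1.comp (Filter.tendsto_id.const_mul_atTop' three_pos)
  have hx := (continuous_expand (R := ℂ) three_ne_zero).tendsto
  have hL := ((h3.mul (((continuous_rescale ω).tendsto e).comp h3)).mul
    (((continuous_rescale (ω ^ 2)).tendsto e).comp h3)).mul ((hx _).comp ((hx e).comp h1))
  have hR := ((hx e).comp h3).mul (((hx e).comp h1).pow 3)
  rw [pow_succ' _ 3]
  exact tendsto_nhds_unique (hL.congr fun n => prod_rescale_qFact hω n) hR

theorem rescale_expand {R : Type*} [CommRing R] {m : ℕ} (hm : m ≠ 0) {ω : R} (hω : ω ^ m = 1)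
    (f : R⟦X⟧) : rescale ω (expand m hm f) = expand m hm f := by
  ext n
  rw [coeff_rescale, coeff_expand]
  split_ifs with h
  · obtain ⟨k, rfl⟩ := h
    rw [pow_mul, hω, one_pow, one_mul]
  · rw [mul_zero]

theorem expand_injective {R : Type*} [CommRing R] {m : ℕ} (hm : m ≠ 0) :
    Function.Injective (expand m hm : R⟦X⟧ → R⟦X⟧) := by
  intro f g h
  ext n
  rw [← coeff_expand_mul m hm, h, coeff_expand_mul]

/-- The relation between the first component of the 3-dissection of `E ^ 3` and Euler products. -/
theorem multisect_eulerE_cube_relation :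
    (multisect 3 0 (eulerE 1 ^ 3) ^ 3 - 27 * X * expand 3 three_ne_zero (eulerE 1) ^ 9) *
      expand 3 three_ne_zero (eulerE 1) ^ 3 = eulerE 1 ^ 12 := by
  have hp := Complex.isPrimitiveRoot_exp 3 three_ne_zero
  obtain ⟨ω, hω⟩ : ∃ ω : ℂ, 1 + ω + ω ^ 2 = 0 := by
    have := hp.geom_sum_eq_zero (by norm_num)
    exact ⟨_, by simpa [Finset.sum_range_succ] using this⟩
  have hω3 : ω ^ 3 = 1 := by linear_combination (ω - 1) * hω
  have hω23 : (ω ^ 2) ^ 3 = 1 := by rw [← pow_mul, mul_comm, pow_mul, hω3, one_pow]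
  have hC : 1 + (C ω : ℂ⟦X⟧) + C ω ^ 2 = 0 := by
    rw [← map_pow, ← map_one C, ← map_add, ← map_add, hω, map_zero]
  have hN := prod_rescale_eulerE hω _ rfl
  -- After X ↦ X^3 and over ℂ, the bracket is the product of the conjugates P(X^3) - 3 ω^i X E_9^3
  -- of E^3, and `hN` evaluates that product as (E_3^4 / E_9)^3.
  apply expand_injective three_ne_zero
  apply map_injective (Int.castRingHom ℂ) Int.cast_injective
  have hd := congrArg (PowerSeries.map (Int.castRingHom ℂ)) eulerE_cube_dissection
  simp only [map_mul, map_sub, map_pow, map_expand, map_ofNat, map_X, expand_X] at hd ⊢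
  set e := PowerSeries.map (Int.castRingHom ℂ) (eulerE 1)
  set P := PowerSeries.map (Int.castRingHom ℂ) (multisect 3 0 (eulerE 1 ^ 3))
  have hd1 := congrArg (rescale ω) hd
  have hd2 := congrArg (rescale (ω ^ 2)) hd
  simp only [map_mul, map_sub, map_pow (rescale _), rescale_expand three_ne_zero hω3,
    rescale_expand three_ne_zero hω23, map_ofNat, rescale_X] at hd1 hd2
  set ee := expand 3 three_ne_zero (expand 3 three_ne_zero e)
  set φP := expand 3 three_ne_zero P
  have h4 : expand 3 three_ne_zero e ^ 12 = (expand 3 three_ne_zero e ^ 4) ^ 3 := by ring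
  rw [h4, ← hN, mul_pow, mul_pow, mul_pow, hd, hd1, hd2, map_pow]
  linear_combination ee ^ 3 * (φP ^ 2 * (3 * X * ee ^ 3) - φP * (3 * X * ee ^ 3) ^ 2 * C ω +
    (3 * X * ee ^ 3) ^ 3 * (C ω - 1)) * hC

end Norm

/-! ### The operator U on polynomials in w -/

section Recurrence

/-- If `w` satisfies a cubic equation over `ℤ[S(X ^ 3)]` of the given shape, then `multisect 3 0`
maps polynomials in `w` to polynomials in `S`. -/
theorem exists_multisect_aeval_eq {w S : ℤ⟦X⟧}
    (hw3 : w ^ 3 = expand 3 three_ne_zero (1 + S) * (3 * w ^ 2 - 3 * w + 1))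
    (hw1 : multisect 3 0 w = 1 + S) (hw2 : multisect 3 0 (w ^ 2) = (1 + S) * (1 + 3 * S))
    (g : Polynomial ℤ) :
    ∃ r : Polynomial ℤ, multisect 3 0 (Polynomial.aeval w g) = Polynomial.aeval S r := by
  have h1 : multisect 3 0 (1 : ℤ⟦X⟧) = 1 := by
    simpa using multisect_X_pow_mul_expand (R := ℤ) three_ne_zero three_pos three_pos 1
  have hpow : ∀ n : ℕ, ∃ r : Polynomial ℤ, multisect 3 0 (w ^ n) = Polynomial.aeval S r := by
    intro n
    induction n using Nat.strong_induction_on with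
    | _ n ih =>
      match n with
      | 0 => exact ⟨1, by simp [h1]⟩
      | 1 => exact ⟨1 + Polynomial.X, by simp [hw1]⟩
      | 2 => exact ⟨(1 + Polynomial.X) * (1 + (3 : ℤ) • Polynomial.X), by
        simp only [map_mul, map_add, map_one, map_zsmul, Polynomial.aeval_X, hw2]
        norm_num [zsmul_eq_mul]⟩
      | n + 3 =>
        obtain ⟨r0, h0⟩ := ih n (by omega)
        obtain ⟨r1, h1⟩ := ih (n + 1) (by omega)
        obtain ⟨r2, h2⟩ := ih (n + 2) (by omega)
        -- The cubic times w^n is a three-term recurrence whose common factor is a series in X^3, so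
        -- it passes through U.
        refine ⟨(1 + Polynomial.X) * ((3 : ℤ) • r2 - (3 : ℤ) • r1 + r0), ?_⟩
        have : w ^ (n + 3) = expand 3 three_ne_zero (1 + S) *
            ((3 : ℤ) • w ^ (n + 2) - (3 : ℤ) • w ^ (n + 1) + w ^ n) := by
          rw [pow_add, hw3]
          simp only [zsmul_eq_mul]
          push_cast
          ring
        rw [this, multisect_expand_mul three_ne_zero 0 three_pos]
        simp only [map_add, map_sub, map_zsmul, h0, h1, h2, map_mul, map_one, Polynomial.aeval_X]
  induction g using Polynomial.induction_on' with
  | add p q hp hq =>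
    obtain ⟨a, ha⟩ := hp
    obtain ⟨b, hb⟩ := hq
    exact ⟨a + b, by rw [map_add, map_add, ha, hb, map_add]⟩
  | monomial n c =>
    obtain ⟨r, hr⟩ := hpow n
    exact ⟨c • r, by
      rw [Polynomial.aeval_monomial, ← Algebra.smul_def, map_smul, hr, map_smul]⟩

theorem constantCoeff_aeval (f : ℤ⟦X⟧) (g : Polynomial ℤ) :
    constantCoeff (Polynomial.aeval f g) = g.eval (constantCoeff f) := by
  rw [Polynomial.aeval_def, Polynomial.hom_eval₂, Polynomial.eval]
  congr 1

/-- Polynomials in `w` that vanish at `w = 1` are mapped to multiples of `S`. -/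
theorem exists_multisect_aeval_eq_mul {w S : ℤ⟦X⟧}
    (hw3 : w ^ 3 = expand 3 three_ne_zero (1 + S) * (3 * w ^ 2 - 3 * w + 1))
    (hw1 : multisect 3 0 w = 1 + S) (hw2 : multisect 3 0 (w ^ 2) = (1 + S) * (1 + 3 * S))
    (hw0 : constantCoeff w = 1) (hS0 : constantCoeff S = 0)
    (g : Polynomial ℤ) (hg : g.eval 1 = 0) :
    ∃ r : Polynomial ℤ, multisect 3 0 (Polynomial.aeval w g) = S * Polynomial.aeval S r := by
  obtain ⟨r, hr⟩ := exists_multisect_aeval_eq hw3 hw1 hw2 g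
  -- U preserves constant terms, so r(0) = g(1) = 0 and r is divisible by the variable.
  have h0 := congrArg constantCoeff hr
  rw [constantCoeff_aeval, hS0, ← coeff_zero_eq_constantCoeff_apply, coeff_multisect, mul_zero,
    zero_add, coeff_zero_eq_constantCoeff_apply, constantCoeff_aeval, hw0, hg] at h0
  obtain ⟨s, hs⟩ := (Polynomial.dvd_iff_isRoot (p := r) (a := 0)).2 h0.symm
  refine ⟨s, ?_⟩
  rw [hr, hs]
  simp

end Recurrence

/-! ### The series w and u and their algebraic relations -/

/-- The first component of the 3-dissection of `E ^ 3`. -/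
noncomputable def dissectP : ℤ⟦X⟧ := multisect 3 0 (eulerE 1 ^ 3)

/-- The inverse of the Euler product. -/
noncomputable def eulerInv : ℤ⟦X⟧ := invOfUnit (eulerE 1) 1

/-- The quotient of `dissectP (X ^ 3)` by `E ^ 3`. -/
noncomputable def wSeries : ℤ⟦X⟧ := expand 3 three_ne_zero dissectP * eulerInv ^ 3

/-- The eta quotient `3 X E(X ^ 3) ^ 12 / E(X) ^ 12`. -/
noncomputable def uSeries : ℤ⟦X⟧ :=
  3 * X * expand 3 three_ne_zero (eulerE 1) ^ 12 * eulerInv ^ 12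

section Series

theorem eulerE_mul_eulerInv : eulerE 1 * eulerInv = 1 :=
  mul_invOfUnit _ _ (by simp [eulerE_constantCoeff 1 one_pos])

theorem constantCoeff_eulerInv : constantCoeff eulerInv = 1 := by
  have h := congrArg constantCoeff eulerE_mul_eulerInv
  simpa [eulerE_constantCoeff 1 one_pos] using h

theorem constantCoeff_dissectP : constantCoeff dissectP = 1 := by
  rw [dissectP, ← coeff_zero_eq_constantCoeff_apply, coeff_multisect, mul_zero, zero_add,
    coeff_zero_eq_constantCoeff_apply]
  simp [eulerE_constantCoeff 1 one_pos]

theorem constantCoeff_wSeries : constantCoeff wSeries = 1 := by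
  simp [wSeries, constantCoeff_dissectP, constantCoeff_eulerInv]

theorem constantCoeff_uSeries : constantCoeff uSeries = 0 := by
  simp [uSeries]

theorem wSeries_mul_eulerE_cube : wSeries * eulerE 1 ^ 3 = expand 3 three_ne_zero dissectP := by
  rw [wSeries, mul_assoc, ← mul_pow, mul_comm eulerInv, eulerE_mul_eulerInv, one_pow, mul_one]

theorem wSeries_sub_one_mul_eulerE_cube : (wSeries - 1) * eulerE 1 ^ 3 =
    3 * X * expand 3 three_ne_zero (expand 3 three_ne_zero (eulerE 1)) ^ 3 := by
  have h := eulerE_cube_dissection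
  rw [← dissectP] at h
  linear_combination wSeries_mul_eulerE_cube - h

theorem uSeries_mul_eulerE_pow :
    uSeries * eulerE 1 ^ 12 = 3 * X * expand 3 three_ne_zero (eulerE 1) ^ 12 := by
  rw [uSeries, mul_assoc, ← mul_pow, mul_comm eulerInv, eulerE_mul_eulerInv, one_pow, mul_one]

theorem eulerE_ne_zero : eulerE 1 ≠ 0 := (isUnit_eulerE one_pos).ne_zero

theorem dissectP_cube_mul :
    dissectP ^ 3 * expand 3 three_ne_zero (eulerE 1) ^ 3 = eulerE 1 ^ 12 * (1 + 9 * uSeries) := by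
  have h := multisect_eulerE_cube_relation
  rw [← dissectP] at h
  linear_combination h - 9 * uSeries_mul_eulerE_pow

/-- The quadratic is w^3 - (w - 1)^3, and the cubes of P(X^3) = w E^3 and 3X E_9^3 = (w - 1) E^3 are
the two terms of the norm relation at X^3. -/
theorem wSeries_quadratic_mul : (3 * wSeries ^ 2 - 3 * wSeries + 1) * (eulerE 1 ^ 9 *
    expand 3 three_ne_zero (expand 3 three_ne_zero (eulerE 1)) ^ 3) =
      expand 3 three_ne_zero (eulerE 1) ^ 12 := by
  have h := congrArg (expand 3 three_ne_zero) multisect_eulerE_cube_relation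
  rw [← dissectP] at h
  simp only [map_mul, map_sub, map_pow, map_ofNat, expand_X] at h
  rw [← h, ← wSeries_mul_eulerE_cube]
  have h3 := congrArg (· ^ 3) wSeries_sub_one_mul_eulerE_cube
  linear_combination
    (-expand 3 three_ne_zero (expand 3 three_ne_zero (eulerE 1)) ^ 3) * h3

theorem eulerE_pow_mul_expand_ne_zero (a b : ℕ) : eulerE 1 ^ a *
    expand 3 three_ne_zero (expand 3 three_ne_zero (eulerE 1)) ^ b ≠ 0 :=
  (((isUnit_eulerE one_pos).pow a).mul
    ((((isUnit_eulerE one_pos).map _).map _).pow b)).ne_zero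

theorem uSeries_eq : uSeries = (wSeries - 1) * (3 * wSeries ^ 2 - 3 * wSeries + 1) := by
  refine mul_right_cancel₀ (eulerE_pow_mul_expand_ne_zero 12 3) ?_
  rw [← mul_assoc, uSeries_mul_eulerE_pow]
  linear_combination
    (-3 * X * expand 3 three_ne_zero (expand 3 three_ne_zero (eulerE 1)) ^ 3) *
      wSeries_quadratic_mul - (3 * wSeries ^ 2 - 3 * wSeries + 1) * eulerE 1 ^ 9 *
      expand 3 three_ne_zero (expand 3 three_ne_zero (eulerE 1)) ^ 3 *
      wSeries_sub_one_mul_eulerE_cube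

theorem wSeries_cube : wSeries ^ 3 = expand 3 three_ne_zero (1 + 9 * uSeries) *
    (3 * wSeries ^ 2 - 3 * wSeries + 1) := by
  have h := congrArg (expand 3 three_ne_zero) dissectP_cube_mul
  rw [map_mul _ (eulerE 1 ^ 12), map_mul, map_pow, map_pow, map_pow,
    ← wSeries_mul_eulerE_cube] at h
  refine mul_right_cancel₀ (eulerE_pow_mul_expand_ne_zero 9 3) ?_
  rw [mul_assoc _ (3 * wSeries ^ 2 - 3 * wSeries + 1), wSeries_quadratic_mul]
  linear_combination h

theorem wSeries_ne_zero : wSeries ≠ 0 := fun h => by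
  simpa [h] using constantCoeff_wSeries

/-- Dividing the dissection of E^3 by P(X^3) gives 1/w = 1 - X k(X^3): unlike w, its inverse
involves only two residue classes, one of them constant. -/
theorem exists_wSeries_mul_eq_sub_one :
    ∃ k : ℤ⟦X⟧, wSeries * (X * expand 3 three_ne_zero k) = wSeries - 1 := by
  have hP : dissectP * invOfUnit dissectP 1 = 1 :=
    mul_invOfUnit _ _ (by simp [constantCoeff_dissectP])
  refine ⟨3 * expand 3 three_ne_zero (eulerE 1) ^ 3 * invOfUnit dissectP 1, ?_⟩
  refine mul_right_cancel₀ (pow_ne_zero 3 eulerE_ne_zero) ?_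
  have hP' := congrArg (expand 3 three_ne_zero) hP
  rw [map_mul, map_one, ← wSeries_mul_eulerE_cube] at hP'
  rw [wSeries_sub_one_mul_eulerE_cube]
  simp only [map_mul, map_pow, map_ofNat]
  linear_combination
    3 * X * expand 3 three_ne_zero (expand 3 three_ne_zero (eulerE 1)) ^ 3 * hP'

/-- Put z = 1 - 1/w = X k(X^3) and S = 9u. The cubic becomes (1 + S(X^3))(1 - z^3) = 1, so w = 1/(1
- z) = (1 + S(X^3))(1 + z + z^2). Powers of z lie in single residue classes, so U keeps 1 here and 1
+ 2z^3 in (1 + z + z^2)^2. -/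
theorem multisect_wSeries_and_sq : multisect 3 0 wSeries = 1 + 9 * uSeries ∧
    multisect 3 0 (wSeries ^ 2) = (1 + 9 * uSeries) * (1 + 3 * (9 * uSeries)) := by
  obtain ⟨k, hk⟩ := exists_wSeries_mul_eq_sub_one
  obtain ⟨z, hz⟩ : ∃ z, z = X * expand 3 three_ne_zero k := ⟨_, rfl⟩
  rw [← hz] at hk
  have hw : wSeries = expand 3 three_ne_zero (1 + 9 * uSeries) * (1 + z + z ^ 2) := by
    refine mul_left_cancel₀ (pow_ne_zero 2 wSeries_ne_zero) ?_
    linear_combination wSeries_cube - expand 3 three_ne_zero (1 + 9 * uSeries) *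
      (2 * wSeries - 1 + wSeries * z) * hk
  have hz3 : z ^ 3 = expand 3 three_ne_zero (X * k ^ 3) := by
    rw [hz, map_mul, map_pow, expand_X]
    ring
  have hX : (1 + 9 * uSeries) * (X * k ^ 3) = 9 * uSeries := by
    apply expand_injective three_ne_zero
    rw [map_mul, ← hz3]
    refine mul_left_cancel₀ (pow_ne_zero 3 wSeries_ne_zero) ?_
    have h3 := congrArg (· ^ 3) hk
    have hc := wSeries_cube
    simp only [map_add, map_one] at h3 hc ⊢
    linear_combination (1 + expand 3 three_ne_zero (9 * uSeries)) * h3 + hc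
  have h0 : ∀ f : ℤ⟦X⟧, multisect 3 0 (expand 3 three_ne_zero f) = f := fun f => by
    simpa using multisect_X_pow_mul_expand (R := ℤ) three_ne_zero three_pos three_pos f
  have h1 : ∀ f : ℤ⟦X⟧, multisect 3 0 (X ^ 1 * expand 3 three_ne_zero f) = 0 := fun f => by
    simpa using multisect_X_pow_mul_expand (R := ℤ) three_ne_zero three_pos
      (show 1 < 3 by norm_num) f
  have h2 : ∀ f : ℤ⟦X⟧, multisect 3 0 (X ^ 2 * expand 3 three_ne_zero f) = 0 := fun f => by
    simpa using multisect_X_pow_mul_expand (R := ℤ) three_ne_zero three_pos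
      (show 2 < 3 by norm_num) f
  constructor
  · have e : 1 + z + z ^ 2 = expand 3 three_ne_zero 1 + X ^ 1 * expand 3 three_ne_zero k +
        X ^ 2 * expand 3 three_ne_zero (k ^ 2) := by
      rw [hz, map_one, map_pow]
      ring
    rw [hw, e, multisect_expand_mul three_ne_zero 0 three_pos, map_add, map_add, h0, h1, h2]
    ring
  · have e : wSeries ^ 2 = expand 3 three_ne_zero ((1 + 9 * uSeries) ^ 2) *
        (expand 3 three_ne_zero (1 + 2 * (X * k ^ 3)) +
          X ^ 1 * expand 3 three_ne_zero (2 * k + X * k ^ 3 * k) +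
          X ^ 2 * expand 3 three_ne_zero (3 * k ^ 2)) := by
      rw [hw]
      simp only [map_add, map_one, map_mul (expand 3 three_ne_zero) 2,
        map_mul (expand 3 three_ne_zero) (X * k ^ 3), ← hz3, map_pow, map_ofNat,
        map_mul (expand 3 three_ne_zero) 3]
      rw [hz]
      ring
    rw [e, multisect_expand_mul three_ne_zero 0 three_pos, map_add, map_add, h0, h1, h2]
    linear_combination (2 * (1 + 9 * uSeries)) * hX

end Series

/-! ### Powers of 3 along the progressions -/

section Congruences

/-- Shifting by X^s moves class m - s into class 0, so every extraction can be done by U at the cost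
of one factor X. -/
theorem multisect_zero_X_pow_mul {R : Type*} [CommRing R] {m s : ℕ} (hs : 0 < s) (hsm : s ≤ m)
    (f : R⟦X⟧) : multisect m 0 (X ^ s * f) = X * multisect m (m - s) f := by
  ext n
  rcases n with _ | n
  · simp [coeff_X_pow_mul', hs.ne']
  · rw [coeff_multisect, coeff_succ_X_mul, coeff_multisect, coeff_X_pow_mul', if_pos]
    · rw [mul_add_one, add_zero, Nat.add_sub_assoc hsm]
    · rw [mul_add_one]
      omega

theorem exists_multisect_aeval_wSeries (g : Polynomial ℤ) (hg : g.eval 1 = 0) :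
    ∃ r : Polynomial ℤ, multisect 3 0 (Polynomial.aeval wSeries g) =
      9 * uSeries * Polynomial.aeval (9 * uSeries) r :=
  exists_multisect_aeval_eq_mul wSeries_cube multisect_wSeries_and_sq.1 multisect_wSeries_and_sq.2
    constantCoeff_wSeries (by simp [constantCoeff_uSeries]) g hg

theorem exists_aeval_wSeries_eq (r : Polynomial ℤ) : ∃ g : Polynomial ℤ,
    Polynomial.aeval (9 * uSeries) r = Polynomial.aeval wSeries g := by
  refine ⟨r.comp ((9 : ℤ) • ((Polynomial.X - 1) *
    ((3 : ℤ) • Polynomial.X ^ 2 - (3 : ℤ) • Polynomial.X + 1))), ?_⟩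
  rw [Polynomial.aeval_comp, uSeries_eq]
  congr 2
  simp only [map_zsmul, map_mul, map_sub, map_add, map_one, map_pow, Polynomial.aeval_X]
  norm_num [zsmul_eq_mul]

/-- Both u and 9u are polynomials in w, and u contains the factor w - 1, so the argument vanishes at
w = 1. -/
theorem exists_multisect_uSeries_mul (r g : Polynomial ℤ) : ∃ s : Polynomial ℤ,
    multisect 3 0 (uSeries * Polynomial.aeval (9 * uSeries) r * Polynomial.aeval wSeries g) =
      9 * uSeries * Polynomial.aeval (9 * uSeries) s := by
  obtain ⟨h, hh⟩ := exists_aeval_wSeries_eq r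
  obtain ⟨s, hs⟩ := exists_multisect_aeval_wSeries ((Polynomial.X - 1) *
    ((3 : ℤ) • Polynomial.X ^ 2 - (3 : ℤ) • Polynomial.X + 1) * h * g) (by simp)
  refine ⟨s, ?_⟩
  rw [← hs, hh]
  conv_lhs => rw [uSeries_eq]
  congr 1
  simp only [map_zsmul, map_mul, map_sub, map_add, map_one, map_pow, Polynomial.aeval_X]
  norm_num [zsmul_eq_mul]

/-- Beyond the generic 9 there is an extra 3. The nonconstant part of r brings its own factor 9. For
the constant part, uw = (w^2 - w) + 3(w - 1)(w^3 - w^2): here U(w^2 - w) = 27u(1 + 9u), and the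
second term carries an explicit 3. -/
theorem exists_multisect_uSeries_mul_wSeries (r : Polynomial ℤ) : ∃ s : ℤ⟦X⟧,
    multisect 3 0 (uSeries * Polynomial.aeval (9 * uSeries) r * wSeries) = 27 * uSeries * s := by
  obtain ⟨r', c, rfl⟩ : ∃ (r' : Polynomial ℤ) (c : ℤ), r = Polynomial.X * r' + Polynomial.C c :=
    ⟨r.divX, r.coeff 0, (Polynomial.X_mul_divX_add r).symm⟩
  obtain ⟨s, hs⟩ := exists_multisect_uSeries_mul r' ((Polynomial.X - 1) *
    ((3 : ℤ) • Polynomial.X ^ 2 - (3 : ℤ) • Polynomial.X + 1) * Polynomial.X)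
  obtain ⟨t, ht⟩ := exists_multisect_aeval_wSeries
    ((Polynomial.X - 1) * (Polynomial.X ^ 3 - Polynomial.X ^ 2)) (by simp)
  have hu : Polynomial.aeval wSeries (((Polynomial.X - 1) *
      ((3 : ℤ) • Polynomial.X ^ 2 - (3 : ℤ) • Polynomial.X + 1) * Polynomial.X : Polynomial ℤ)) =
      uSeries * wSeries := by
    rw [uSeries_eq]
    simp only [map_zsmul, map_mul, map_sub, map_add, map_one, map_pow, Polynomial.aeval_X]
    norm_num [zsmul_eq_mul]
  rw [hu] at hs
  simp only [map_mul, map_sub, map_one, map_pow, Polynomial.aeval_X] at ht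
  have huw : uSeries * wSeries = wSeries ^ 2 - wSeries +
      (3 : ℤ) • ((wSeries - 1) * (wSeries ^ 3 - wSeries ^ 2)) := by
    rw [uSeries_eq, zsmul_eq_mul]
    push_cast
    ring
  have e : uSeries * Polynomial.aeval (9 * uSeries) (Polynomial.X * r' + Polynomial.C c) *
      wSeries = (9 : ℤ) • (uSeries * Polynomial.aeval (9 * uSeries) r' * (uSeries * wSeries)) +
        c • (wSeries ^ 2 - wSeries +
          (3 : ℤ) • ((wSeries - 1) * (wSeries ^ 3 - wSeries ^ 2))) := by
    rw [← huw, map_add, map_mul, Polynomial.aeval_X, Polynomial.aeval_C, zsmul_eq_mul,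
      zsmul_eq_mul]
    simp only [eq_intCast]
    push_cast
    ring
  refine ⟨3 * Polynomial.aeval (9 * uSeries) s +
    c * (1 + 9 * uSeries + Polynomial.aeval (9 * uSeries) t), ?_⟩
  rw [e, map_add, map_zsmul, map_zsmul, map_add, map_sub, map_zsmul, hs, ht,
    multisect_wSeries_and_sq.1, multisect_wSeries_and_sq.2]
  simp only [zsmul_eq_mul]
  push_cast
  ring

/-- The generating function of `p_{3,3}` along the progression `3 ^ α n + (3 ^ α + 1) / 2`. -/
noncomputable def genProgression (α : ℕ) : ℤ⟦X⟧ :=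
  mk fun n => pTriple 3 (3 ^ α * n + (3 ^ α + 1) / 2)

theorem two_mul_half_three_pow (α : ℕ) : 2 * ((3 ^ α + 1) / 2) = 3 ^ α + 1 :=
  Nat.two_mul_div_two_of_even ((Odd.pow (by decide)).add_one)

theorem genProgression_one : genProgression 1 = multisect 3 2 (genP 3) := by
  ext n
  simp [genProgression, pTriple]

theorem genProgression_succ (α : ℕ) :
    genProgression (α + 1) = multisect 3 1 (genProgression α) := by
  ext n
  rw [coeff_multisect, genProgression, genProgression, coeff_mk, coeff_mk]
  congr 1
  have h1 := two_mul_half_three_pow α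
  have h2 := two_mul_half_three_pow (α + 1)
  rw [pow_succ] at h2 ⊢
  have : 3 ^ α * (3 * n + 1) = 3 ^ α * 3 * n + 3 ^ α := by ring
  omega

/-- The induction starts from U(w - 1) = 9u, since w - 1 = 3X E_9^3 E_3^3 times the generating
function. Both sides are compared after multiplication by 3 because w - 1, not (w - 1)/3, is a
polynomial in w over ℤ. -/
theorem genProgression_relation (α : ℕ) (hα : 1 ≤ α) : ∃ r : Polynomial ℤ,
    eulerE 1 ^ 3 * expand 3 three_ne_zero (eulerE 1) ^ 3 * (X * genProgression α) =
      3 ^ α * (uSeries * Polynomial.aeval (9 * uSeries) r) := by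
  have h3 : (3 : ℤ⟦X⟧) ≠ 0 := fun h => by
    have h0 := congrArg constantCoeff h
    rw [map_ofNat, map_zero] at h0
    norm_num at h0
  have hm : ∀ f : ℤ⟦X⟧, multisect 3 0 (expand 3 three_ne_zero
      (3 * (eulerE 1 ^ 3 * expand 3 three_ne_zero (eulerE 1) ^ 3)) * f) =
      3 * (eulerE 1 ^ 3 * expand 3 three_ne_zero (eulerE 1) ^ 3) * multisect 3 0 f := fun f =>
    multisect_expand_mul three_ne_zero 0 three_pos _ f
  induction α, hα using Nat.le_induction with
  | base =>
    refine ⟨1, mul_left_cancel₀ h3 ?_⟩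
    have hX := multisect_zero_X_pow_mul (show 0 < 1 by norm_num) (show 1 ≤ 3 by norm_num) (genP 3)
    have h := genP_spec 3 three_pos
    rw [eulerE_eq_expand three_ne_zero] at h
    have e : wSeries - 1 = expand 3 three_ne_zero
        (3 * (eulerE 1 ^ 3 * expand 3 three_ne_zero (eulerE 1) ^ 3)) * (X ^ 1 * genP 3) := by
      simp only [map_mul, map_pow, map_ofNat]
      linear_combination (-(wSeries - 1)) * h + genP 3 *
        expand 3 three_ne_zero (eulerE 1) ^ 3 * wSeries_sub_one_mul_eulerE_cube
    have h1 : multisect 3 0 (1 : ℤ⟦X⟧) = 1 := by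
      simpa using multisect_X_pow_mul_expand (R := ℤ) three_ne_zero three_pos three_pos 1
    rw [genProgression_one, ← mul_assoc, ← hX, ← hm, ← e, map_sub, multisect_wSeries_and_sq.1, h1,
      map_one]
    ring
  | succ α hα ih =>
    obtain ⟨r, hr⟩ := ih
    obtain ⟨s, hs⟩ := exists_multisect_uSeries_mul r (Polynomial.X - 1)
    refine ⟨s, mul_left_cancel₀ h3 ?_⟩
    have hX := multisect_zero_X_pow_mul (show 0 < 2 by norm_num) (show 2 ≤ 3 by norm_num)
      (genProgression α)
    have e : (3 : ℤ) ^ α • (uSeries * Polynomial.aeval (9 * uSeries) r *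
        Polynomial.aeval wSeries (Polynomial.X - 1 : Polynomial ℤ)) = expand 3 three_ne_zero
        (3 * (eulerE 1 ^ 3 * expand 3 three_ne_zero (eulerE 1) ^ 3)) *
          (X ^ 2 * genProgression α) := by
      simp only [map_mul, map_pow, map_ofNat, map_sub, Polynomial.aeval_X, map_one, zsmul_eq_mul]
      push_cast
      linear_combination (-(wSeries - 1)) * hr + X * genProgression α *
        expand 3 three_ne_zero (eulerE 1) ^ 3 * wSeries_sub_one_mul_eulerE_cube
    rw [genProgression_succ, ← mul_assoc, ← hX, ← hm, ← e, map_zsmul, hs, zsmul_eq_mul]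
    push_cast
    ring

/-- The power beyond 3^α is the explicit 3 in u, whose factor X cancels the shift. -/
theorem three_pow_dvd_genProgression (α : ℕ) (hα : 1 ≤ α) :
    (3 : ℤ⟦X⟧) ^ (α + 1) ∣ genProgression α := by
  obtain ⟨r, hr⟩ := genProgression_relation α hα
  have hU : IsUnit (eulerE 1 ^ 3 * expand 3 three_ne_zero (eulerE 1) ^ 3) :=
    ((isUnit_eulerE one_pos).pow 3).mul (((isUnit_eulerE one_pos).map _).pow 3)
  rw [← hU.dvd_mul_left]
  refine ⟨expand 3 three_ne_zero (eulerE 1) ^ 12 * eulerInv ^ 12 *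
    Polynomial.aeval (9 * uSeries) r, mul_left_cancel₀ X_ne_zero ?_⟩
  nth_rewrite 1 [uSeries] at hr
  linear_combination hr

theorem three_pow_dvd_multisect_genProgression (α : ℕ) (hα : 1 ≤ α) :
    (3 : ℤ⟦X⟧) ^ (α + 4) ∣ multisect 3 2 (genProgression α) := by
  obtain ⟨r, hr⟩ := genProgression_relation α hα
  obtain ⟨s, hs⟩ := exists_multisect_uSeries_mul_wSeries r
  have hU : IsUnit (eulerE 1 ^ 3 * dissectP) := by
    refine ((isUnit_eulerE one_pos).pow 3).mul ?_
    rw [isUnit_iff_constantCoeff, constantCoeff_dissectP]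
    exact isUnit_one
  have hX := multisect_zero_X_pow_mul (show 0 < 1 by norm_num) (show 1 ≤ 3 by norm_num)
    (genProgression α)
  -- Multiplying by w replaces E^3 by P(X^3), leaving a single factor X, so U picks class 2 instead
  -- of class 1.
  have e : (3 : ℤ) ^ α • (uSeries * Polynomial.aeval (9 * uSeries) r * wSeries) =
      expand 3 three_ne_zero (eulerE 1 ^ 3 * dissectP) * (X ^ 1 * genProgression α) := by
    rw [zsmul_eq_mul, map_mul, map_pow]
    push_cast
    linear_combination (-wSeries) * hr + X * genProgression α *
      expand 3 three_ne_zero (eulerE 1) ^ 3 * wSeries_mul_eulerE_cube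
  have hm := congrArg (multisect 3 0) e
  rw [multisect_expand_mul three_ne_zero 0 three_pos, hX, map_zsmul, hs, zsmul_eq_mul, uSeries]
    at hm
  push_cast at hm
  rw [← hU.dvd_mul_left]
  refine ⟨expand 3 three_ne_zero (eulerE 1) ^ 12 * eulerInv ^ 12 * s,
    mul_left_cancel₀ X_ne_zero ?_⟩
  linear_combination -hm

theorem modEq_zero_of_three_pow_dvd {k : ℕ} {f : ℤ⟦X⟧} (h : (3 : ℤ⟦X⟧) ^ k ∣ f) (n : ℕ) :
    coeff n f ≡ 0 [ZMOD 3 ^ k] := by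
  obtain ⟨g, rfl⟩ := h
  have : (3 : ℤ⟦X⟧) ^ k = C ((3 : ℤ) ^ k) := by simp
  rw [this, coeff_C_mul]
  exact Int.modEq_zero_iff_dvd.2 (dvd_mul_right _ _)

end Congruences

theorem theorem2 (n α : ℕ) (hα : 1 ≤ α) :
    pTriple 3 (3 ^ α * n + (3 ^ α + 1) / 2) ≡ 0 [ZMOD 3 ^ (α + 1)] ∧
    pTriple 3 (3 ^ (α + 1) * n + (5 * 3 ^ α + 1) / 2) ≡ 0 [ZMOD 3 ^ (α + 4)] := by
  constructor
  · simpa [genProgression] using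
      modEq_zero_of_three_pow_dvd (three_pow_dvd_genProgression α hα) n
  · have h := modEq_zero_of_three_pow_dvd (three_pow_dvd_multisect_genProgression α hα) n
    rw [coeff_multisect, genProgression, coeff_mk] at h
    -- The indices agree because 2·3^α + (3^α + 1)/2 = (5·3^α + 1)/2.
    convert h using 2
    have h1 := two_mul_half_three_pow α
    rw [pow_succ]
    have : 3 ^ α * (3 * n + 2) = 3 ^ α * 3 * n + 2 * 3 ^ α := by ring
    omega
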